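/- **Problem.** Let $\Omega,T$ be finite sets, let $C\subset\mathbb R^n$ be compact, let $I\subseteq\{1,\dots,n\}$, and let $\mathbb X=\{X\in C: X_i\in\mathbb Z\ \forall i\in I\}$ be nonempty. Consider the two-stage stochastic mixed-integer second-order cone program $$\min_{X,Y}\ c^\top X+\sum_{\omega\in\Omega}\sum_{t\in T} d_{\omega t}^\top Y_{\omega t}\quad\text{s.t.}\quad \|A_{\omega tj}X+B_{\omega tj}Y_{\omega t}+e_{\omega tj}\|_2\le c_{\omega tj}^\top X+d_{\omega tj}^\top Y_{\omega t}+f_{\omega tj}\ \ \forall\omega,t,j,\qquad X\in\mathbb X,$$ with finitely many cones $j$ for each $(\omega,t)$. Let $v^*$ be its optimal value; its continuous relaxation is the same problem with $X\in C$. The total cost of $X$ is $F(X)=c^\top X+\inf_Y\sum_{\omega,t}d_{\omega t}^\top Y_{\omega t}$, the infimum being over all $Y$ feasible together with $X$. Assume that for every $X\in C$ and every $(\omega,t)$ some $Y_{\omega t}$ satisfies all cone constraints strictly, and that the continuous relaxation has positive optimal value. **Algorithm.** The dual sub-problem of $(\omega,t)$ at $\hat X$ is to maximize $\sum_j\bigl(-u_{\omega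 tj}^\top(A_{\omega tj}\hat X+e_{\omega tj})-\mu_{\omega tj}(c_{\omega tj}^\top\hat X+f_{\omega tj})\bigr)$ subject to $\sum_j(B_{\omega tj}^\top u_{\omega tj}+\mu_{\omega tj}d_{\omega tj})=d_{\omega t}$ and $\|u_{\omega tj}\|_2\le\mu_{\omega tj}$ for all $j$. Dual solutions $(\hat u,\hat\mu)$ of all sub-problems define the cut $$z\ \ge\ \sum_{\omega,t,j}\bigl(-\hat u_{\omega tj}^\top(A_{\omega tj}X+e_{\omega tj})-\hat\mu_{\omega tj}(c_{\omega tj}^\top X+f_{\omega tj})\bigr).$$ The master problem minimizes $c^\top X+z$ over $X\in\mathbb X$ and $z\in[-\infty,\infty]$ subject to all cuts generated so far; the relaxed master problem has $X\in C$ instead. Let $\varepsilon_1>0$. Start with $LB=-\infty$, $UB=+\infty$, $Gap=+\infty$, $flag=0$ and no cuts. An iteration consists of: 0. if $Gap\le\varepsilon_1$ and $flag=0$, set $UB=+\infty$, $flag=1$; 1. find an optimal solution $(\hat X,\hat z)$ of the master problem if $flag=1$, of the relaxed master problem if $flag=0$, and set $LB=c^\top\hat X+\hat z$; 2. find an optimal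 solution of every dual sub-problem at $\hat X$, set $UB$ to the minimum of $UB$ and $c^\top\hat X$ plus the sum of the dual optimal values, and record $\hat X$ as the best iterate if this decreases $UB$; 3. add the cut defined by these dual solutions; 4. set $Gap=(UB-LB)/UB$. The algorithm stops when $flag=1$ and $Gap\le\varepsilon_2$, and returns the best iterate. The algorithm without acceleration starts with $flag=1$ instead. Any optimal solutions may be chosen in steps 1 and 2. **Theorem.** Let either $\varepsilon_2>0$, or $\varepsilon_2=0$ and $\mathbb X$ finite. The following holds for the algorithm both with and without acceleration. (a) $v^*$ is finite, and $F(X)=v^*$ for some $X\in\mathbb X$. (b) Every iteration can be carried out: the master problems and dual sub-problems that occur have optimal solutions. (c) Every cut ever generated, also those for the relaxed master problem, is valid for the relaxed and hence for the integer problem: it holds with $z=\sum_{\omega,t}d_{\omega t}^\top Y_{\omega t}$ at every $(X,Y)$ feasible for the continuous relaxation. Whenever $flag=1$ after an iteration, $LB\le v^*\le UB$. (d) Every run stops after finitely many iterations. The returned $\hat X$ lies in $\mathbb X$, $UB=F(\hat X)$, and $\hat X$ is globally optimal up to the relative gap $\varepsilon_2$: $0\le F(\hat X)-v^*\le\varepsilon_2F(\hat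 X)$. In particular, if $\mathbb X$ is finite and $\varepsilon_2=0$, a global optimum is reached exactly after finitely many iterations. (e) If the iterations are continued without the stopping test, then $flag=1$ from some iteration on, $LB\to v^*$, $UB\to v^*$, and every cluster point $X$ of the sequence of iterates $\hat X$ lies in $\mathbb X$ and satisfies $F(X)=v^*$. -/

import Mathlib

open Filter Topology
open scoped Matrix

noncomputable section

namespace GBD

/-- Euclidean norm of a column vector. -/
def norm2 {k : ℕ} (v : Fin k → ℝ) : ℝ := ‖(WithLp.toLp 2 v : EuclideanSpace ℝ (Fin k))‖

/-- Data of the second-stage problem of one hour of one scenario, with `n` first-stage variables: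
minimise `d ⬝ Y` subject to `‖A j X + B j Y + e j‖₂ ≤ cX j ⬝ X + dY j ⬝ Y + f j` for every cone `j`.
The number of variables, of cones, and the size of each cone are arbitrary. -/
structure SubProblem (n : ℕ) where
  numVars : ℕ
  numCones : ℕ
  dim : Fin numCones → ℕ
  d : Fin numVars → ℝ
  A : ∀ j, Matrix (Fin (dim j)) (Fin n) ℝ
  B : ∀ j, Matrix (Fin (dim j)) (Fin numVars) ℝ
  e : ∀ j, Fin (dim j) → ℝ
  cX : Fin numCones → Fin n → ℝ
  dY : Fin numCones → Fin numVars → ℝ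
  f : Fin numCones → ℝ

namespace SubProblem

variable {n : ℕ} (S : SubProblem n)

/-- All second-order cone constraints hold at `(X, Y)`. -/
def Feasible (X : Fin n → ℝ) (Y : Fin S.numVars → ℝ) : Prop :=
  ∀ j, norm2 (S.A j *ᵥ X + S.B j *ᵥ Y + S.e j) ≤ S.cX j ⬝ᵥ X + S.dY j ⬝ᵥ Y + S.f j

/-- Given `X`, some `Y` satisfies all second-order cone constraints strictly. -/
def StrictlyFeasible (X : Fin n → ℝ) : Prop :=
  ∃ Y : Fin S.numVars → ℝ, ∀ j,
    norm2 (S.A j *ᵥ X + S.B j *ᵥ Y + S.e j) < S.cX j ⬝ᵥ X + S.dY j ⬝ᵥ Y + S.f j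

/-- The variables `(u, μ)` of the dual sub-problem. -/
structure DualVar (S : SubProblem n) where
  u : ∀ j : Fin S.numCones, Fin (S.dim j) → ℝ
  μ : Fin S.numCones → ℝ

/-- The constraints of the dual sub-problem. -/
def DualFeasible (w : S.DualVar) : Prop :=
  (∑ j, ((S.B j)ᵀ *ᵥ w.u j + w.μ j • S.dY j)) = S.d ∧ ∀ j, norm2 (w.u j) ≤ w.μ j

/-- The objective of the dual sub-problem at the first-stage decision `X`. -/
def dualObj (X : Fin n → ℝ) (w : S.DualVar) : ℝ :=
  ∑ j, (-(w.u j ⬝ᵥ (S.A j *ᵥ X + S.e j)) - w.μ j * (S.cX j ⬝ᵥ X + S.f j))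

/-- `w` is an optimal solution of the dual sub-problem at `X`. -/
def DualOptimal (X : Fin n → ℝ) (w : S.DualVar) : Prop :=
  S.DualFeasible w ∧ ∀ w', S.DualFeasible w' → S.dualObj X w' ≤ S.dualObj X w

end SubProblem

/-- A two-stage stochastic mixed-integer second-order cone program with scenarios `Ω` and hours `T`.
The first-stage feasible set is given by its continuous relaxation `relaxedSet` and the set `intVars`
of coordinates that have to be integers. -/
structure Problem (n : ℕ) (Ω T : Type*) where
  c : Fin n → ℝ
  sub : Ω → T → SubProblem n
  relaxedSet : Set (Fin n → ℝ)
  intVars : Set (Fin n)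

namespace Problem

variable {n : ℕ} {Ω T : Type*} (P : Problem n Ω T)

/-- The feasible set `𝕏` of the first stage. -/
def integerSet : Set (Fin n → ℝ) :=
  {X | X ∈ P.relaxedSet ∧ ∀ i ∈ P.intVars, ∃ k : ℤ, X i = k}

/-- Second-stage decisions, one vector for every hour of every scenario. -/
abbrev Second : Type _ := ∀ ω t, Fin (P.sub ω t).numVars → ℝ

/-- Dual variables of all sub-problems. They determine one optimality cut. -/
abbrev Multipliers : Type _ := ∀ ω t, (P.sub ω t).DualVar

/-- Feasibility of `(X, Y)`, with first-stage set `D`. -/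
def Feasible (D : Set (Fin n → ℝ)) (X : Fin n → ℝ) (Y : P.Second) : Prop :=
  X ∈ D ∧ ∀ ω t, (P.sub ω t).Feasible X (Y ω t)

variable [Fintype Ω] [Fintype T]

/-- The second-stage part of the objective. -/
def secondCost (Y : P.Second) : ℝ := ∑ ω, ∑ t, (P.sub ω t).d ⬝ᵥ Y ω t

/-- Optimal value with first-stage set `D`, in `[-∞, ∞]`: for `D = P.integerSet` it is the optimal
value of the program, for `D = P.relaxedSet` that of its continuous relaxation. -/
def optVal (D : Set (Fin n → ℝ)) : EReal :=
  ⨅ (X : Fin n → ℝ) (Y : P.Second) (_ : P.Feasible D X Y),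
    ((P.c ⬝ᵥ X + P.secondCost Y : ℝ) : EReal)

/-- The total cost of the first-stage decision `X`, the second stage being optimised. -/
def planCost (X : Fin n → ℝ) : EReal := P.optVal {X}

/-- The right-hand side of the optimality cut `z ≥ …` defined by `w`, as a function of `X`. -/
def cutVal (w : P.Multipliers) (X : Fin n → ℝ) : ℝ := ∑ ω, ∑ t, (P.sub ω t).dualObj X (w ω t)

/-- `(X, z)` is feasible for the master problem with first-stage set `D` and the given cuts.
The variable `z` ranges over `[-∞, ∞]`, so that the master problem without cuts has value `-∞`. -/
def MasterFeasible (D : Set (Fin n → ℝ)) (cuts : List P.Multipliers) (X : Fin n → ℝ) (z : EReal) :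
    Prop :=
  X ∈ D ∧ ∀ w ∈ cuts, ((P.cutVal w X : ℝ) : EReal) ≤ z

/-- `(X, z)` is an optimal solution of the master problem. -/
def MasterOptimal (D : Set (Fin n → ℝ)) (cuts : List P.Multipliers) (X : Fin n → ℝ) (z : EReal) :
    Prop :=
  P.MasterFeasible D cuts X z ∧ ∀ X' z', P.MasterFeasible D cuts X' z' →
    ((P.c ⬝ᵥ X : ℝ) : EReal) + z ≤ ((P.c ⬝ᵥ X' : ℝ) : EReal) + z'

/-- The variables of the algorithm. `best` is the iterate whose cost is `ub`; the entries `xhat`,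
`zhat`, `best` have no meaning before the first iteration. -/
structure State (P : Problem n Ω T) where
  iter : ℕ
  flag : Bool
  lb : EReal
  ub : EReal
  gap : EReal
  xhat : Fin n → ℝ
  zhat : EReal
  best : Fin n → ℝ
  cuts : List P.Multipliers

/-- Initialisation. `flag₀ = false` is the accelerated algorithm; with `flag₀ = true` the phase with
the relaxed master problem is skipped (Generalized Benders Decomposition without acceleration). -/
def start (flag₀ : Bool) : P.State where
  iter := 0
  flag := flag₀
  lb := ⊥
  ub := ⊤
  gap := ⊤
  xhat := 0
  zhat := ⊥
  best := 0
  cuts := []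

/-- The condition of Step 0 for restoring the integer constraints. -/
def Switch (ε₁ : ℝ) (s : P.State) : Prop := s.gap ≤ (ε₁ : EReal) ∧ s.flag = false

open Classical in
/-- The upper bound after Step 0. -/
def resetUB (ε₁ : ℝ) (s : P.State) : EReal := if P.Switch ε₁ s then ⊤ else s.ub

/-- The first-stage set of the master problem solved while the flag has the given value. -/
def masterSet (flag : Bool) : Set (Fin n → ℝ) := if flag then P.integerSet else P.relaxedSet

/-- One iteration takes the state `s` to `s'`, where `w` are the dual solutions found in Step 2.
It is a relation, as the master problem and the dual problems may have several optimal solutions. -/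
structure StepWith (ε₁ : ℝ) (s s' : P.State) (w : P.Multipliers) : Prop where
  iter_eq : s'.iter = s.iter + 1
  flag_iff : s'.flag = true ↔ s.flag = true ∨ P.Switch ε₁ s
  master : P.MasterOptimal (P.masterSet s'.flag) s.cuts s'.xhat s'.zhat
  lb_eq : s'.lb = ((P.c ⬝ᵥ s'.xhat : ℝ) : EReal) + s'.zhat
  dual : ∀ ω t, (P.sub ω t).DualOptimal s'.xhat (w ω t)
  ub_eq : s'.ub =
    min (P.resetUB ε₁ s) ((P.c ⬝ᵥ s'.xhat + P.cutVal w s'.xhat : ℝ) : EReal)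
  best_new : ((P.c ⬝ᵥ s'.xhat + P.cutVal w s'.xhat : ℝ) : EReal) < P.resetUB ε₁ s →
    s'.best = s'.xhat
  best_old : P.resetUB ε₁ s ≤ ((P.c ⬝ᵥ s'.xhat + P.cutVal w s'.xhat : ℝ) : EReal) →
    s'.best = s.best
  cuts_eq : s'.cuts = s.cuts ++ [w]
  gap_eq : s'.gap = (s'.ub - s'.lb) / s'.ub

/-- One iteration of the algorithm. -/
def Step (ε₁ : ℝ) (s s' : P.State) : Prop := ∃ w, P.StepWith ε₁ s s' w

/-- States that occur after finitely many iterations. -/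
def Reachable (ε₁ : ℝ) (flag₀ : Bool) (s : P.State) : Prop :=
  Relation.ReflTransGen (P.Step ε₁) (P.start flag₀) s

/-- The stopping test: the integer constraints are in force and the gap is at most `ε₂`. -/
def Terminated (ε₂ : ℝ) (s : P.State) : Prop := s.flag = true ∧ s.gap ≤ (ε₂ : EReal)

end Problem

end GBD

end

/-! Under Slater's condition strong duality holds with dual attainment (`exists_dualFeasible_ge`). A
cut is therefore a lower bound of the recourse function on all of `relaxedSet`, and it is tight at
the iterate that produced it. This does not depend on which master problem produced the iterate, so
cuts survive the switch of the flag.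

Convergence is a compactness argument. Slater points bound the optimal multipliers uniformly on
`relaxedSet`, so all cuts share one modulus `ρ` with `ρ 0 = 0` (`exists_modulus`). If an iterate x
comes after an iterate y, the cut of y yields LB ≥ F(x) - ρ(x - y), with `ρ` symmetrised. Infinitely
many iterates violating LB ≥ F(x) - ε would accumulate and contradict this
(`eventually_cost_sub_le_lb`).

Since UB ≤ F(x) and UB is at least the positive relaxed optimum, the relative gap is eventually at
most any positive tolerance; this forces the switch and, for ε₂ > 0, the stop. If 𝕏 is finite, an
iterate repeats and `ρ 0 = 0` closes the gap exactly. That the bounds enclose the current optimal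
value is an invariant of the iteration. -/

namespace GBD

/-! ### The Euclidean norm and self-duality of the second-order cone -/

section Norm2

variable {k : ℕ}

theorem norm2_nonneg (v : Fin k → ℝ) : 0 ≤ norm2 v := norm_nonneg _

theorem norm2_add_le (v w : Fin k → ℝ) : norm2 (v + w) ≤ norm2 v + norm2 w := by
  simp only [norm2, WithLp.toLp_add]
  exact norm_add_le _ _

theorem norm2_smul (a : ℝ) (v : Fin k → ℝ) : norm2 (a • v) = |a| * norm2 v := by
  simp only [norm2, WithLp.toLp_smul, norm_smul, Real.norm_eq_abs]

theorem norm2_neg (v : Fin k → ℝ) : norm2 (-v) = norm2 v := by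
  simp only [norm2, WithLp.toLp_neg, norm_neg]

theorem norm2_zero : norm2 (0 : Fin k → ℝ) = 0 := by
  simp only [norm2, WithLp.toLp_zero, norm_zero]

theorem continuous_norm2 : Continuous (norm2 : (Fin k → ℝ) → ℝ) :=
  continuous_norm.comp (PiLp.continuous_toLp 2 _)

theorem dotProduct_self_eq_norm2_sq (v : Fin k → ℝ) : v ⬝ᵥ v = norm2 v ^ 2 := by
  rw [norm2, EuclideanSpace.real_norm_sq_eq]
  simp [dotProduct, pow_two]

theorem abs_dotProduct_le (v w : Fin k → ℝ) : |v ⬝ᵥ w| ≤ norm2 v * norm2 w := by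
  have h := abs_real_inner_le_norm (WithLp.toLp 2 v : EuclideanSpace ℝ (Fin k)) (WithLp.toLp 2 w)
  rwa [EuclideanSpace.inner_toLp_toLp, star_trivial, dotProduct_comm] at h

theorem neg_mul_le_dotProduct {v w : Fin k → ℝ} {m t : ℝ} (hv : norm2 v ≤ m) (hw : norm2 w ≤ t) :
    -(m * t) ≤ v ⬝ᵥ w := by
  have h1 := neg_abs_le (v ⬝ᵥ w)
  have h2 := abs_dotProduct_le v w
  have h3 := mul_le_mul hv hw (norm2_nonneg w) ((norm2_nonneg v).trans hv)
  linarith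

/-- The second-order cone is self-dual. -/
theorem norm2_le_of_forall_cone {u : Fin k → ℝ} {m : ℝ}
    (h : ∀ v t, norm2 v < t → 0 ≤ u ⬝ᵥ v + m * t) : norm2 u ≤ m := by
  have hm : 0 ≤ m := by simpa using h 0 1 (by simp [norm2_zero])
  have key : norm2 u ^ 2 ≤ m * norm2 u := by
    refine le_of_forall_pos_le_add fun ε hε => ?_
    have h1 := h (-u) (norm2 u + ε / (m + 1)) (by rw [norm2_neg]; linarith [div_pos hε (by linarith : 0 < m + 1)])
    rw [dotProduct_neg, dotProduct_self_eq_norm2_sq] at h1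
    have h2 : m * (ε / (m + 1)) ≤ ε := by
      rw [mul_div_assoc', div_le_iff₀ (by linarith)]
      nlinarith
    linarith
  rcases (norm2_nonneg u).eq_or_lt with h0 | h0
  · rwa [← h0]
  · nlinarith

end Norm2

/-! ### Weak duality and the set of perturbed problems -/

namespace SubProblem

variable {n : ℕ} (S : SubProblem n)

/-- The vector inside the norm of cone `j`. -/
def conePoint (X : Fin n → ℝ) (Y : Fin S.numVars → ℝ) (j : Fin S.numCones) : Fin (S.dim j) → ℝ :=
  S.A j *ᵥ X + S.B j *ᵥ Y + S.e j

/-- The right-hand side of cone `j`. -/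
def coneRadius (X : Fin n → ℝ) (Y : Fin S.numVars → ℝ) (j : Fin S.numCones) : ℝ :=
  S.cX j ⬝ᵥ X + S.dY j ⬝ᵥ Y + S.f j

/-- The linear functional `Y ↦ ∑ⱼ (Bⱼᵀ uⱼ + μⱼ dⱼ) ⬝ Y`, and the Lagrangian identity. -/
theorem dualObj_eq (X : Fin n → ℝ) (Y : Fin S.numVars → ℝ) (w : S.DualVar) :
    S.dualObj X w = (∑ j, ((S.B j)ᵀ *ᵥ w.u j + w.μ j • S.dY j)) ⬝ᵥ Y -
      ∑ j, (w.u j ⬝ᵥ S.conePoint X Y j + w.μ j * S.coneRadius X Y j) := by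
  rw [dualObj, sum_dotProduct, ← Finset.sum_sub_distrib]
  refine Finset.sum_congr rfl fun j _ => ?_
  simp only [conePoint, coneRadius, add_dotProduct, dotProduct_add, smul_dotProduct,
    Matrix.mulVec_transpose, ← Matrix.dotProduct_mulVec, smul_eq_mul]
  ring

theorem mul_slack_le {X : Fin n → ℝ} {Y : Fin S.numVars → ℝ} {w : S.DualVar}
    (hw : S.DualFeasible w) (j : Fin S.numCones) :
    w.μ j * (S.coneRadius X Y j - norm2 (S.conePoint X Y j)) ≤
      w.u j ⬝ᵥ S.conePoint X Y j + w.μ j * S.coneRadius X Y j := by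
  have := neg_mul_le_dotProduct (hw.2 j) (le_refl (norm2 (S.conePoint X Y j)))
  linarith

theorem DualFeasible.μ_nonneg {S : SubProblem n} {w : S.DualVar} (hw : S.DualFeasible w)
    (j : Fin S.numCones) : 0 ≤ w.μ j := (norm2_nonneg _).trans (hw.2 j)

/-- The duality gap is a sum over the cones of nonnegative terms, each dominating multiplier times
slack. This is what later bounds the multipliers. -/
theorem mul_slack_le_sub_dualObj {X : Fin n → ℝ} {Y : Fin S.numVars → ℝ} {w : S.DualVar}
    (hw : S.DualFeasible w) (hY : S.Feasible X Y) (j : Fin S.numCones) :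
    w.μ j * (S.coneRadius X Y j - norm2 (S.conePoint X Y j)) ≤ S.d ⬝ᵥ Y - S.dualObj X w := by
  rw [S.dualObj_eq X Y w, hw.1, sub_sub_cancel]
  refine (S.mul_slack_le hw j).trans ?_
  refine Finset.single_le_sum
    (f := fun j => w.u j ⬝ᵥ S.conePoint X Y j + w.μ j * S.coneRadius X Y j)
    (fun i _ => ?_) (Finset.mem_univ j)
  exact (mul_nonneg (hw.μ_nonneg i) (sub_nonneg.2 (hY i))).trans (S.mul_slack_le hw i)

theorem weak_duality {X : Fin n → ℝ} {Y : Fin S.numVars → ℝ} {w : S.DualVar}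
    (hw : S.DualFeasible w) (hY : S.Feasible X Y) : S.dualObj X w ≤ S.d ⬝ᵥ Y := by
  have h : 0 ≤ S.d ⬝ᵥ Y - S.dualObj X w := by
    rw [S.dualObj_eq X Y w, hw.1, sub_sub_cancel]
    exact Finset.sum_nonneg fun i _ =>
      (mul_nonneg (hw.μ_nonneg i) (sub_nonneg.2 (hY i))).trans (S.mul_slack_le hw i)
  linarith

/-- Perturbations of the cone constraints and strict upper bounds of the objective that are
attained by some `Y`. -/
def perturbed (X : Fin n → ℝ) : Set ((∀ j, Fin (S.dim j) → ℝ) × (Fin S.numCones → ℝ) × ℝ) :=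
  {q | ∃ Y, (∀ j, norm2 (S.conePoint X Y j + q.1 j) < S.coneRadius X Y j + q.2.1 j) ∧
    S.d ⬝ᵥ Y < q.2.2}

/-- The strict inequalities in the definition give openness, so Hahn–Banach separates a point from
the set strictly. -/
theorem isOpen_perturbed (X : Fin n → ℝ) : IsOpen (S.perturbed X) := by
  have : S.perturbed X = ⋃ Y, ((⋂ j, {q | norm2 (S.conePoint X Y j + q.1 j) <
      S.coneRadius X Y j + q.2.1 j}) ∩ {q | S.d ⬝ᵥ Y < q.2.2}) := by
    ext q; simp [perturbed]
  rw [this]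
  refine isOpen_iUnion fun Y => (isOpen_iInter_of_finite fun j => isOpen_lt ?_ ?_).inter
    (isOpen_lt ?_ ?_)
  · exact continuous_norm2.comp (by fun_prop)
  all_goals fun_prop

theorem conePoint_combo (X : Fin n → ℝ) (Y Y' : Fin S.numVars → ℝ) (j : Fin S.numCones)
    {a b : ℝ} (hab : a + b = 1) :
    S.conePoint X (a • Y + b • Y') j = a • S.conePoint X Y j + b • S.conePoint X Y' j := by
  obtain rfl : a = 1 - b := by linarith
  simp only [conePoint, Matrix.mulVec_add, Matrix.mulVec_smul]
  module

theorem coneRadius_combo (X : Fin n → ℝ) (Y Y' : Fin S.numVars → ℝ) (j : Fin S.numCones)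
    {a b : ℝ} (hab : a + b = 1) :
    S.coneRadius X (a • Y + b • Y') j = a * S.coneRadius X Y j + b * S.coneRadius X Y' j := by
  obtain rfl : a = 1 - b := by linarith
  simp only [coneRadius, dotProduct_add, dotProduct_smul, smul_eq_mul]
  ring

theorem mul_add_mul_lt_of_lt {a b x y x' y' : ℝ} (ha : 0 ≤ a) (hb : 0 ≤ b) (hab : a + b = 1)
    (hx : x < x') (hy : y < y') : a * x + b * y < a * x' + b * y' := by
  rcases ha.eq_or_lt with rfl | ha
  · obtain rfl : b = 1 := by linarith
    linarith
  · have := mul_lt_mul_of_pos_left hx ha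
    have := mul_le_mul_of_nonneg_left hy.le hb
    linarith

theorem convex_perturbed (X : Fin n → ℝ) : Convex ℝ (S.perturbed X) := by
  rintro q ⟨Y, hY, hr⟩ q' ⟨Y', hY', hr'⟩ a b ha hb hab
  refine ⟨a • Y + b • Y', fun j => ?_, ?_⟩
  · have h1 : S.conePoint X (a • Y + b • Y') j + (a • q + b • q').1 j =
        a • (S.conePoint X Y j + q.1 j) + b • (S.conePoint X Y' j + q'.1 j) := by
      rw [S.conePoint_combo X Y Y' j hab]
      simp only [Prod.fst_add, Prod.smul_fst, Pi.add_apply, Pi.smul_apply]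
      module
    have h2 : S.coneRadius X (a • Y + b • Y') j + (a • q + b • q').2.1 j =
        a * (S.coneRadius X Y j + q.2.1 j) + b * (S.coneRadius X Y' j + q'.2.1 j) := by
      rw [S.coneRadius_combo X Y Y' j hab]
      simp only [Prod.snd_add, Prod.fst_add, Prod.smul_snd, Prod.smul_fst, Pi.add_apply,
        Pi.smul_apply, smul_eq_mul]
      ring
    rw [h1, h2]
    refine (norm2_add_le _ _).trans_lt ?_
    rw [norm2_smul, norm2_smul, abs_of_nonneg ha, abs_of_nonneg hb]
    exact mul_add_mul_lt_of_lt ha hb hab (hY j) (hY' j)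
  · simp only [dotProduct_add, dotProduct_smul, smul_eq_mul, Prod.snd_add, Prod.smul_snd]
    exact mul_add_mul_lt_of_lt ha hb hab hr hr'

/-- Every linear functional on the space of perturbations has coordinates. -/
theorem exists_coordinates {m : ℕ} {k : Fin m → ℕ}
    (φ : ((∀ j, Fin (k j) → ℝ) × (Fin m → ℝ) × ℝ) →ₗ[ℝ] ℝ) :
    ∃ (u : ∀ j, Fin (k j) → ℝ) (μ : Fin m → ℝ) (l : ℝ), ∀ a b r,
      φ (a, b, r) = ∑ j, (u j ⬝ᵥ a j + μ j * b j) + l * r := by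
  refine ⟨fun j i => φ (Pi.single j (Pi.single i 1), 0, 0), fun j => φ (0, Pi.single j 1, 0),
    φ (0, 0, 1), fun a b r => ?_⟩
  have ha : (a, b, r) = (∑ j, ∑ i, a j i • ((Pi.single j (Pi.single i 1), 0, 0) :
      (∀ j, Fin (k j) → ℝ) × (Fin m → ℝ) × ℝ)) +
      (∑ j, b j • ((0, Pi.single j 1, 0) : (∀ j, Fin (k j) → ℝ) × (Fin m → ℝ) × ℝ)) +
      r • ((0, 0, 1) : (∀ j, Fin (k j) → ℝ) × (Fin m → ℝ) × ℝ) := by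
    refine Prod.ext ?_ (Prod.ext ?_ ?_)
    · ext j i
      simp only [Prod.fst_add, Prod.fst_sum, Prod.smul_fst, smul_zero, Finset.sum_const_zero,
        add_zero, Finset.sum_apply, Pi.smul_apply]
      rw [Finset.sum_eq_single j, Finset.sum_eq_single i]
      · simp
      · intro i' _ h
        simp [h.symm]
      · simp
      · intro j' _ h
        simp [Pi.single_eq_of_ne h.symm]
      · simp
    · ext j
      simp [Prod.fst_sum, Prod.snd_sum, Finset.sum_apply, Pi.single_apply]
    · simp [Prod.snd_sum]
  rw [ha]
  simp only [map_add, map_sum, map_smul, smul_eq_mul, Finset.sum_add_distrib, dotProduct]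
  congr 1
  · congr 1
    · exact Finset.sum_congr rfl fun j _ => Finset.sum_congr rfl fun i _ => mul_comm _ _
    · exact Finset.sum_congr rfl fun j _ => mul_comm _ _
  · exact mul_comm _ _

end SubProblem
end GBD

/-! ### Strong duality, bounded multipliers and equicontinuous cuts -/

namespace GBD

/-- An affine function bounded below on a half-line has no negative slope. In the duality proof this
turns unbounded directions into sign conditions. -/
theorem nonneg_of_forall_pos_lt {C D x : ℝ} (h : ∀ N : ℝ, 0 < N → C < N * x + D) : 0 ≤ x := by
  by_contra! hx
  have h1 := h ((|C - D| + 1) / (-x)) (div_pos (by positivity) (by linarith))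
  rw [div_mul_eq_mul_div, mul_div_assoc, div_neg, div_self hx.ne] at h1
  linarith [neg_abs_le (C - D)]

theorem le_of_forall_pos_lt_mul_add {C D x : ℝ} (h : ∀ δ : ℝ, 0 < δ → C < δ * x + D) : C ≤ D := by
  have h1 : Tendsto (fun δ : ℝ => δ * x + D) (𝓝[>] 0) (𝓝 (0 * x + D)) :=
    tendsto_nhdsWithin_of_tendsto_nhds (by fun_prop : Continuous fun δ : ℝ => δ * x + D).continuousAt
  rw [zero_mul, zero_add] at h1
  exact ge_of_tendsto h1 (eventually_mem_nhdsWithin.mono fun δ hδ => (h δ hδ).le)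

namespace SubProblem

variable {n : ℕ} (S : SubProblem n)

/-- A hyperplane separating the unattainable objective `p` from the perturbation set. -/
theorem exists_separation {X : Fin n → ℝ} {p : ℝ} (hp : ∀ Y, S.Feasible X Y → p ≤ S.d ⬝ᵥ Y) :
    ∃ (u : ∀ j, Fin (S.dim j) → ℝ) (μ : Fin S.numCones → ℝ) (l : ℝ),
      ∀ (Y : Fin S.numVars → ℝ) (v : ∀ j, Fin (S.dim j) → ℝ) (t : Fin S.numCones → ℝ) (s : ℝ),
        (∀ j, norm2 (v j) < t j) → 0 < s →
        l * p < ∑ j, (u j ⬝ᵥ v j + μ j * t j) -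
          ∑ j, (u j ⬝ᵥ S.conePoint X Y j + μ j * S.coneRadius X Y j) + l * (S.d ⬝ᵥ Y + s) := by
  have hmem : ((0, 0, p) : (∀ j, Fin (S.dim j) → ℝ) × (Fin S.numCones → ℝ) × ℝ) ∉
      S.perturbed X := by
    rintro ⟨Y, hY, hr⟩
    refine hr.not_ge (hp Y fun j => ?_)
    have hj := (hY j).le
    simp only [Pi.zero_apply, add_zero] at hj
    exact hj
  obtain ⟨φ, hφ⟩ := geometric_hahn_banach_open_point (S.convex_perturbed X)
    (S.isOpen_perturbed X) hmem
  -- The sign is flipped so that the separated point lies below the set and the multipliers come out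
  -- nonnegative.
  obtain ⟨u, μ, l, h⟩ := exists_coordinates (-φ).toLinearMap
  refine ⟨u, μ, l, fun Y v t s hv hs => ?_⟩
  -- This perturbation moves the cone data of `Y` exactly to `(v, t)`, an arbitrary point of the
  -- open cones.
  have h1 := hφ (fun j => v j - S.conePoint X Y j, fun j => t j - S.coneRadius X Y j, S.d ⬝ᵥ Y + s)
    ⟨Y, fun j => by simpa using hv j, by simpa using hs⟩
  have h2 := h 0 0 p
  have h3 := h (fun j => v j - S.conePoint X Y j) (fun j => t j - S.coneRadius X Y j)
    (S.d ⬝ᵥ Y + s)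
  simp only [ContinuousLinearMap.toLinearMap_neg, LinearMap.neg_apply, ContinuousLinearMap.coe_coe,
    Pi.zero_apply, dotProduct_zero, mul_zero, add_zero, Finset.sum_const_zero, zero_add] at h2 h3
  have h4 : ∑ j, (u j ⬝ᵥ (v j - S.conePoint X Y j) + μ j * (t j - S.coneRadius X Y j)) =
      ∑ j, (u j ⬝ᵥ v j + μ j * t j) -
        ∑ j, (u j ⬝ᵥ S.conePoint X Y j + μ j * S.coneRadius X Y j) := by
    rw [← Finset.sum_sub_distrib]
    refine Finset.sum_congr rfl fun j _ => ?_
    rw [dotProduct_sub]; ring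
  linarith

/-- Strong duality: under Slater's condition, a lower bound of the primal objective is met by a
feasible point of the dual. -/
theorem exists_dualFeasible_ge {X : Fin n → ℝ} (hs : S.StrictlyFeasible X) {p : ℝ}
    (hp : ∀ Y, S.Feasible X Y → p ≤ S.d ⬝ᵥ Y) : ∃ w, S.DualFeasible w ∧ p ≤ S.dualObj X w := by
  obtain ⟨u, μ, l, h⟩ := S.exists_separation hp
  obtain ⟨Y₀, hY₀⟩ := hs
  have hcone : ∀ j, norm2 (u j) ≤ μ j := by
    refine fun j => norm2_le_of_forall_cone fun v t hvt => ?_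
    have h0 : ∀ i, norm2 (Pi.single (M := fun j => Fin (S.dim j) → ℝ) j v i) ≤
        (Pi.single j t : Fin S.numCones → ℝ) i := by
      intro i
      rcases eq_or_ne i j with rfl | hij
      · simpa using hvt.le
      · simp [Pi.single_eq_of_ne hij, norm2_zero]
    have h1 : ∑ i, (u i ⬝ᵥ Pi.single (M := fun j => Fin (S.dim j) → ℝ) j v i +
        μ i * (Pi.single j t : Fin S.numCones → ℝ) i) = u j ⬝ᵥ v + μ j * t := by
      rw [Finset.sum_eq_single j]
      · simp
      · intro i _ hij
        simp [Pi.single_eq_of_ne hij]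
      · simp
    rw [← h1]
    refine nonneg_of_forall_pos_lt (C := l * p) (D := ∑ j, μ j -
      ∑ j, (u j ⬝ᵥ S.conePoint X Y₀ j + μ j * S.coneRadius X Y₀ j) + l * (S.d ⬝ᵥ Y₀ + 1))
      fun N hN => ?_
    -- The perturbation goes to infinity along `(v, t)` in block `j`. The direction vanishes in the
    -- other blocks, so the summand 1 keeps every block strictly inside its cone.
    have h2 := h Y₀ (fun i => N • Pi.single (M := fun j => Fin (S.dim j) → ℝ) j v i)
      (fun i => N * (Pi.single j t : Fin S.numCones → ℝ) i + 1) 1 (fun i => ?_) one_pos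
    · have h3 : ∑ i, (u i ⬝ᵥ (N • Pi.single (M := fun j => Fin (S.dim j) → ℝ) j v i) +
          μ i * (N * (Pi.single j t : Fin S.numCones → ℝ) i + 1)) =
          N * ∑ i, (u i ⬝ᵥ Pi.single (M := fun j => Fin (S.dim j) → ℝ) j v i +
            μ i * (Pi.single j t : Fin S.numCones → ℝ) i) + ∑ i, μ i := by
        rw [Finset.mul_sum, ← Finset.sum_add_distrib]
        refine Finset.sum_congr rfl fun i _ => ?_
        rw [dotProduct_smul, smul_eq_mul]; ring
      linarith
    · rw [norm2_smul, abs_of_pos hN]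
      have := mul_le_mul_of_nonneg_left (h0 i) hN.le
      linarith
  have hμ : ∀ j, 0 ≤ μ j := fun j => (norm2_nonneg _).trans (hcone j)
  have hbase : ∀ Y (δ s : ℝ), 0 < δ → 0 < s → l * p < δ * (∑ j, μ j) -
      ∑ j, (u j ⬝ᵥ S.conePoint X Y j + μ j * S.coneRadius X Y j) + l * (S.d ⬝ᵥ Y + s) := by
    intro Y δ s hδ hs
    have h1 := h Y (fun _ => 0) (fun _ => δ) s (fun _ => by rwa [norm2_zero]) hs
    simp only [dotProduct_zero, zero_add, ← Finset.sum_mul] at h1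
    linarith
  have hl : 0 ≤ l := nonneg_of_forall_pos_lt (C := l * p) (D := 1 * (∑ j, μ j) -
      ∑ j, (u j ⬝ᵥ S.conePoint X Y₀ j + μ j * S.coneRadius X Y₀ j) + l * (S.d ⬝ᵥ Y₀))
      fun N hN => by linarith [hbase Y₀ 1 N one_pos hN]
  -- Letting both the cone perturbation and the objective margin tend to zero leaves the Lagrangian
  -- inequality at `Y`.
  have hlim : ∀ Y, l * p ≤ l * (S.d ⬝ᵥ Y) -
      ∑ j, (u j ⬝ᵥ S.conePoint X Y j + μ j * S.coneRadius X Y j) := fun Y =>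
    le_of_forall_pos_lt_mul_add (x := ∑ j, μ j + l) fun δ hδ => by linarith [hbase Y δ δ hδ hδ]
  -- Strictness of the Slater point enters here. If `l = 0`, the Lagrangian inequality at `Y₀` makes
  -- every multiplier times a positive slack vanish, so all `μ j` are 0, and `hbase` becomes
  -- contradictory.
  have hlpos : 0 < l := by
    refine hl.lt_of_ne fun hl0 => ?_
    subst hl0
    have h1 : ∀ j, μ j * (S.coneRadius X Y₀ j - norm2 (S.conePoint X Y₀ j)) ≤
        u j ⬝ᵥ S.conePoint X Y₀ j + μ j * S.coneRadius X Y₀ j := fun j => by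
      linarith [neg_mul_le_dotProduct (hcone j) (le_refl (norm2 (S.conePoint X Y₀ j)))]
    have h2 := Finset.sum_le_sum fun j (_ : j ∈ Finset.univ) => h1 j
    have h3 : ∀ j ∈ Finset.univ,
        0 ≤ μ j * (S.coneRadius X Y₀ j - norm2 (S.conePoint X Y₀ j)) :=
      fun j _ => mul_nonneg (hμ j) (sub_nonneg.2 (hY₀ j).le)
    have h4 := hlim Y₀
    have h5 := (Finset.sum_eq_zero_iff_of_nonneg h3).1
      (le_antisymm (by linarith) (Finset.sum_nonneg h3))
    have h6 : ∑ j, μ j = 0 := Finset.sum_eq_zero fun j hj =>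
      (mul_eq_zero.1 (h5 j hj)).resolve_right (sub_pos.2 (hY₀ j)).ne'
    have h7 := hbase Y₀ 1 1 one_pos one_pos
    have h8 := Finset.sum_nonneg h3
    rw [h6] at h7
    linarith
  let w : S.DualVar := ⟨fun j => l⁻¹ • u j, fun j => l⁻¹ * μ j⟩
  have hw : ∀ Y, p ≤ (S.d - ∑ j, ((S.B j)ᵀ *ᵥ w.u j + w.μ j • S.dY j)) ⬝ᵥ Y + S.dualObj X w := by
    intro Y
    have h1 : ∑ j, (w.u j ⬝ᵥ S.conePoint X Y j + w.μ j * S.coneRadius X Y j) =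
        l⁻¹ * ∑ j, (u j ⬝ᵥ S.conePoint X Y j + μ j * S.coneRadius X Y j) := by
      rw [Finset.mul_sum]
      refine Finset.sum_congr rfl fun j _ => ?_
      simp only [w, smul_dotProduct, smul_eq_mul]; ring
    have h2 := mul_le_mul_of_nonneg_left (hlim Y) (inv_nonneg.2 hl)
    rw [mul_sub, inv_mul_cancel_left₀ hlpos.ne', inv_mul_cancel_left₀ hlpos.ne'] at h2
    rw [S.dualObj_eq X Y w, h1, sub_dotProduct]
    linarith
  -- The inequality `hw` bounds an affine function of `Y` from below on the whole space, so its
  -- gradient `g` is zero; it is tested along `-(N • g)`.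
  have hzero : S.d - ∑ j, ((S.B j)ᵀ *ᵥ w.u j + w.μ j • S.dY j) = 0 := by
    set g := S.d - ∑ j, ((S.B j)ᵀ *ᵥ w.u j + w.μ j • S.dY j)
    refine dotProduct_self_eq_zero.1 (le_antisymm ?_ ?_)
    · refine neg_nonneg.1 (nonneg_of_forall_pos_lt (C := p - 1) (D := S.dualObj X w) fun N _ => ?_)
      have := hw (-(N • g))
      rw [dotProduct_neg, dotProduct_smul, smul_eq_mul] at this
      linarith
    · rw [dotProduct_self_eq_norm2_sq]; positivity
  refine ⟨w, ⟨(sub_eq_zero.1 hzero).symm, fun j => ?_⟩, by simpa [hzero] using hw 0⟩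
  simp only [w, norm2_smul, abs_of_pos (inv_pos.2 hlpos)]
  exact mul_le_mul_of_nonneg_left (hcone j) (inv_nonneg.2 hl)

/-- The optimal value of the second-stage problem at `X`. -/
noncomputable def value (X : Fin n → ℝ) : ℝ := sInf ((S.d ⬝ᵥ ·) '' {Y | S.Feasible X Y})

theorem StrictlyFeasible.exists_feasible {S : SubProblem n} {X : Fin n → ℝ}
    (hs : S.StrictlyFeasible X) : ∃ Y, S.Feasible X Y :=
  hs.imp fun _ hY j => (hY j).le

/-- Feasible second stage, bounded from below, with Slater's condition. -/
structure Regular (X : Fin n → ℝ) : Prop where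
  strict : S.StrictlyFeasible X
  bddBelow : BddBelow ((S.d ⬝ᵥ ·) '' {Y | S.Feasible X Y})

variable {S}

theorem Regular.value_le {X : Fin n → ℝ} (h : S.Regular X) {Y : Fin S.numVars → ℝ}
    (hY : S.Feasible X Y) : S.value X ≤ S.d ⬝ᵥ Y := csInf_le h.bddBelow ⟨Y, hY, rfl⟩

theorem Regular.exists_lt {X : Fin n → ℝ} (h : S.Regular X) {ε : ℝ} (hε : 0 < ε) :
    ∃ Y, S.Feasible X Y ∧ S.d ⬝ᵥ Y < S.value X + ε := by
  obtain ⟨Y, hY⟩ := h.strict.exists_feasible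
  obtain ⟨_, ⟨Y, hY, rfl⟩, h2⟩ := exists_lt_of_csInf_lt (s := (S.d ⬝ᵥ ·) '' {Y | S.Feasible X Y})
    ⟨_, Y, hY, rfl⟩ (lt_add_of_pos_right (S.value X) hε)
  exact ⟨Y, hY, h2⟩

theorem Regular.dualObj_le {X : Fin n → ℝ} (h : S.Regular X) {w : S.DualVar}
    (hw : S.DualFeasible w) : S.dualObj X w ≤ S.value X := by
  obtain ⟨Y, hY⟩ := h.strict.exists_feasible
  exact le_csInf ⟨_, Y, hY, rfl⟩ (by rintro _ ⟨Y, hY, rfl⟩; exact S.weak_duality hw hY)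

theorem Regular.exists_dualFeasible {X : Fin n → ℝ} (h : S.Regular X) :
    ∃ w, S.DualFeasible w ∧ S.value X ≤ S.dualObj X w :=
  S.exists_dualFeasible_ge h.strict fun _ hY => h.value_le hY

theorem Regular.exists_dualOptimal {X : Fin n → ℝ} (h : S.Regular X) :
    ∃ w, S.DualOptimal X w := by
  obtain ⟨w, hw, hv⟩ := h.exists_dualFeasible
  exact ⟨w, hw, fun w' hw' => (h.dualObj_le hw').trans hv⟩

theorem Regular.dualObj_eq_value {X : Fin n → ℝ} (h : S.Regular X) {w : S.DualVar}
    (hw : S.DualOptimal X w) : S.dualObj X w = S.value X := by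
  obtain ⟨w', hw', hv⟩ := h.exists_dualFeasible
  exact (h.dualObj_le hw.1).antisymm (hv.trans (hw.2 w' hw'))

variable (S)

theorem continuous_dualObj (w : S.DualVar) : Continuous fun X => S.dualObj X w := by
  unfold dualObj; fun_prop

/-- Optimal multipliers are locally bounded. -/
theorem exists_bound_nhds {X₀ : Fin n → ℝ} (h : S.Regular X₀) (j : Fin S.numCones) :
    ∃ M, ∀ᶠ X in 𝓝 X₀, ∀ w, S.DualOptimal X w → w.μ j ≤ M := by
  obtain ⟨Y, hY⟩ := h.strict
  obtain ⟨w₀, hw₀, -⟩ := h.exists_dualFeasible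
  have hcont : ∀ i, Continuous fun X => S.coneRadius X Y i - norm2 (S.conePoint X Y i) := by
    intro i
    refine Continuous.sub (by unfold coneRadius; fun_prop) (continuous_norm2.comp ?_)
    unfold conePoint; fun_prop
  set δ := S.coneRadius X₀ Y j - norm2 (S.conePoint X₀ Y j) with hδ
  have hδ0 : 0 < δ := sub_pos.2 (hY j)
  have e1 : ∀ᶠ X in 𝓝 X₀, ∀ i, 0 < S.coneRadius X Y i - norm2 (S.conePoint X Y i) :=
    eventually_all.2 fun i => (hcont i).continuousAt.eventually_const_lt (sub_pos.2 (hY i))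
  have e2 : ∀ᶠ X in 𝓝 X₀, δ / 2 < S.coneRadius X Y j - norm2 (S.conePoint X Y j) :=
    (hcont j).continuousAt.eventually_const_lt (half_lt_self hδ0)
  have e3 : ∀ᶠ X in 𝓝 X₀, S.dualObj X₀ w₀ - 1 < S.dualObj X w₀ :=
    (S.continuous_dualObj w₀).continuousAt.eventually_const_lt (sub_one_lt _)
  -- Near `X₀` the same `Y` keeps slack above `δ / 2` in cone `j`. Multiplier times slack is at most
  -- the gap between `Y` and `w`, and `w` is no worse than the fixed `w₀`, whose objective drops by
  -- less than 1.
  refine ⟨(S.d ⬝ᵥ Y - S.dualObj X₀ w₀ + 1) / (δ / 2), ?_⟩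
  filter_upwards [e1, e2, e3] with X h1 h2 h3 w hw
  rw [le_div_iff₀ (half_pos hδ0)]
  have h4 := S.mul_slack_le_sub_dualObj hw.1 (fun i => (sub_pos.1 (h1 i)).le) j
  have h5 := mul_le_mul_of_nonneg_left h2.le (hw.1.μ_nonneg j)
  have h6 := hw.2 w₀ hw₀
  linarith

theorem exists_bound {C : Set (Fin n → ℝ)} (hC : IsCompact C) (h : ∀ X ∈ C, S.Regular X)
    (j : Fin S.numCones) : ∃ M, ∀ X ∈ C, ∀ w, S.DualOptimal X w → w.μ j ≤ M := by
  refine hC.induction_on (p := fun s => ∃ M, ∀ X ∈ s, ∀ w, S.DualOptimal X w → w.μ j ≤ M)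
    ⟨0, by simp⟩ (fun s t hst ⟨M, hM⟩ => ⟨M, fun X hX => hM X (hst hX)⟩) ?_ ?_
  · rintro s t ⟨M, hM⟩ ⟨M', hM'⟩
    refine ⟨max M M', ?_⟩
    rintro X (hX | hX) w hw
    · exact (hM X hX w hw).trans (le_max_left _ _)
    · exact (hM' X hX w hw).trans (le_max_right _ _)
  · intro X hX
    obtain ⟨M, hM⟩ := S.exists_bound_nhds (h X hX) j
    exact ⟨_, mem_nhdsWithin_of_mem_nhds hM, M, fun _ => id⟩

/-- The cuts generated on a compact set are equicontinuous. -/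
theorem exists_modulus {C : Set (Fin n → ℝ)} (hC : IsCompact C) (h : ∀ X ∈ C, S.Regular X) :
    ∃ ρ : (Fin n → ℝ) → ℝ, Continuous ρ ∧ ρ 0 = 0 ∧ ∀ X ∈ C, ∀ w, S.DualOptimal X w →
      ∀ X₁ X₂, S.dualObj X₁ w - S.dualObj X₂ w ≤ ρ (X₁ - X₂) := by
  choose M hM using S.exists_bound hC h
  -- Dual feasibility gives `norm2 (w.u j) ≤ w.μ j ≤ M j`, so bounding `μ` controls all slopes of
  -- the cut.
  refine ⟨fun x => ∑ j, M j * (norm2 (S.A j *ᵥ x) + |S.cX j ⬝ᵥ x|), ?_, ?_, ?_⟩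
  · refine continuous_finsetSum _ fun j _ => continuous_const.mul (.add ?_ (by fun_prop))
    exact continuous_norm2.comp (by fun_prop)
  · simp [norm2_zero]
  · intro X hX w hw X₁ X₂
    rw [dualObj, dualObj, ← Finset.sum_sub_distrib]
    refine Finset.sum_le_sum fun j _ => ?_
    have h1 := hM j X hX w hw
    have h2 := neg_mul_le_dotProduct (hw.1.2 j) (le_refl (norm2 (S.A j *ᵥ (X₁ - X₂))))
    have h3 := mul_le_mul_of_nonneg_left (neg_abs_le (S.cX j ⬝ᵥ (X₁ - X₂))) (hw.1.μ_nonneg j)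
    have h4 : 0 ≤ norm2 (S.A j *ᵥ (X₁ - X₂)) + |S.cX j ⬝ᵥ (X₁ - X₂)| :=
      add_nonneg (norm2_nonneg _) (abs_nonneg _)
    have h5 := mul_le_mul_of_nonneg_right h1 h4
    simp only [Matrix.mulVec_sub, dotProduct_sub, dotProduct_add] at h2 h3 h4 h5 ⊢
    linarith

end SubProblem
end GBD

/-! ### The recourse function, optimal values and solvability of the master problem -/

namespace GBD
namespace Problem

variable {n : ℕ} {Ω T : Type*} (P : Problem n Ω T)

/-- The standing assumptions, with the positivity of the relaxed optimal value replaced by the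
boundedness of the second-stage problems. -/
structure Regular : Prop where
  compact : IsCompact P.relaxedSet
  nonempty : P.integerSet.Nonempty
  sub : ∀ X ∈ P.relaxedSet, ∀ ω t, (P.sub ω t).Regular X

theorem integerSet_subset : P.integerSet ⊆ P.relaxedSet := fun _ h => h.1

theorem masterSet_subset (b : Bool) : P.masterSet b ⊆ P.relaxedSet := by
  cases b
  · exact subset_rfl
  · exact P.integerSet_subset

variable {P} in
theorem isCompact_integerSet (h : IsCompact P.relaxedSet) : IsCompact P.integerSet := by
  have : P.integerSet = P.relaxedSet ∩ ⋂ i ∈ P.intVars, {X | X i ∈ Set.range ((↑) : ℤ → ℝ)} := by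
    ext X
    simp [integerSet, eq_comm]
  rw [this]
  exact h.inter_right (isClosed_biInter fun i _ =>
    Int.isClosedEmbedding_coe_real.isClosed_range.preimage (continuous_apply i))

variable {P} in
theorem isCompact_masterSet (h : IsCompact P.relaxedSet) (b : Bool) : IsCompact (P.masterSet b) := by
  cases b
  · exact h
  · exact isCompact_integerSet h

variable {P} in
theorem masterSet_nonempty (h : P.integerSet.Nonempty) (b : Bool) : (P.masterSet b).Nonempty := by
  cases b
  · exact h.mono P.integerSet_subset
  · exact h

variable {P} in
theorem Regular.exists_dualOptimal (hP : P.Regular) {X : Fin n → ℝ}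
    (hX : X ∈ P.relaxedSet) :
    ∃ w : P.Multipliers, ∀ ω t, (P.sub ω t).DualOptimal X (w ω t) := by
  choose w hw using fun ω t => (hP.sub X hX ω t).exists_dualOptimal
  exact ⟨w, hw⟩

variable [Fintype Ω] [Fintype T]

/-- The optimal second-stage cost of `X`. -/
noncomputable def recourse (X : Fin n → ℝ) : ℝ := ∑ ω, ∑ t, (P.sub ω t).value X

/-- The total cost of `X` as a real number. -/
noncomputable def cost (X : Fin n → ℝ) : ℝ := P.c ⬝ᵥ X + P.recourse X

variable {P}

theorem optVal_le_of_feasible {D : Set (Fin n → ℝ)} {X : Fin n → ℝ} {Y : P.Second}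
    (h : P.Feasible D X Y) : P.optVal D ≤ ((P.c ⬝ᵥ X + P.secondCost Y : ℝ) : EReal) :=
  iInf_le_of_le X (iInf_le_of_le Y (iInf_le_of_le h le_rfl))

/-- If the relaxation is bounded from below, so is every second-stage problem. -/
theorem bddBelow_of_optVal {D : Set (Fin n → ℝ)} (hpos : 0 < P.optVal D)
    (hstrict : ∀ X ∈ D, ∀ ω t, (P.sub ω t).StrictlyFeasible X) {X : Fin n → ℝ} (hX : X ∈ D)
    (ω : Ω) (t : T) :
    BddBelow (((P.sub ω t).d ⬝ᵥ ·) '' {Y | (P.sub ω t).Feasible X Y}) := by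
  choose Y₀ hY₀ using fun ω t => (hstrict X hX ω t).exists_feasible
  by_contra hb
  -- Every unbounded block is lowered by at least the absolute total cost of `Y₀` and no other block
  -- gets worse. One unbounded block then pushes the total cost to at most 0, against positivity.
  have key : ∀ ω' t', ∃ Y, (P.sub ω' t').Feasible X Y ∧
      (P.sub ω' t').d ⬝ᵥ Y ≤ (P.sub ω' t').d ⬝ᵥ Y₀ ω' t' ∧
      (¬ BddBelow (((P.sub ω' t').d ⬝ᵥ ·) '' {Y | (P.sub ω' t').Feasible X Y}) →
        (P.sub ω' t').d ⬝ᵥ Y ≤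
          (P.sub ω' t').d ⬝ᵥ Y₀ ω' t' - |P.c ⬝ᵥ X + P.secondCost Y₀|) := by
    intro ω' t'
    by_cases h : BddBelow (((P.sub ω' t').d ⬝ᵥ ·) '' {Y | (P.sub ω' t').Feasible X Y})
    · exact ⟨Y₀ ω' t', hY₀ ω' t', le_rfl, fun h' => absurd h h'⟩
    · obtain ⟨_, ⟨Y, hY, rfl⟩, hlt⟩ := not_bddBelow_iff.1 h
        ((P.sub ω' t').d ⬝ᵥ Y₀ ω' t' - |P.c ⬝ᵥ X + P.secondCost Y₀|)
      exact ⟨Y, hY, hlt.le.trans (sub_le_self _ (abs_nonneg _)), fun _ => hlt.le⟩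
  choose Y hY hle hlt using key
  have h1 := hpos.trans_le (optVal_le_of_feasible (D := D) (X := X) (Y := Y) ⟨hX, hY⟩)
  rw [EReal.coe_pos] at h1
  have h2 : |P.c ⬝ᵥ X + P.secondCost Y₀| ≤ P.secondCost Y₀ - P.secondCost Y := by
    calc |P.c ⬝ᵥ X + P.secondCost Y₀|
        ≤ (P.sub ω t).d ⬝ᵥ Y₀ ω t - (P.sub ω t).d ⬝ᵥ Y ω t := by linarith [hlt ω t hb]
      _ ≤ ∑ t', ((P.sub ω t').d ⬝ᵥ Y₀ ω t' - (P.sub ω t').d ⬝ᵥ Y ω t') :=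
        Finset.single_le_sum
          (f := fun t' => (P.sub ω t').d ⬝ᵥ Y₀ ω t' - (P.sub ω t').d ⬝ᵥ Y ω t')
          (fun t' _ => sub_nonneg.2 (hle ω t')) (Finset.mem_univ t)
      _ ≤ ∑ ω', ∑ t', ((P.sub ω' t').d ⬝ᵥ Y₀ ω' t' - (P.sub ω' t').d ⬝ᵥ Y ω' t') :=
        Finset.single_le_sum
          (f := fun ω' => ∑ t', ((P.sub ω' t').d ⬝ᵥ Y₀ ω' t' - (P.sub ω' t').d ⬝ᵥ Y ω' t'))
          (fun ω' _ => Finset.sum_nonneg fun t' _ => sub_nonneg.2 (hle ω' t'))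
          (Finset.mem_univ ω)
      _ = P.secondCost Y₀ - P.secondCost Y := by
        simp only [secondCost, Finset.sum_sub_distrib]
  linarith [le_abs_self (P.c ⬝ᵥ X + P.secondCost Y₀)]

theorem regular_of_optVal_pos (hcompact : IsCompact P.relaxedSet) (hne : P.integerSet.Nonempty)
    (hstrict : ∀ X ∈ P.relaxedSet, ∀ ω t, (P.sub ω t).StrictlyFeasible X)
    (hpos : 0 < P.optVal P.relaxedSet) : P.Regular :=
  ⟨hcompact, hne, fun X hX ω t => ⟨hstrict X hX ω t, bddBelow_of_optVal hpos hstrict hX ω t⟩⟩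

theorem cutVal_le_secondCost {D : Set (Fin n → ℝ)} {w : P.Multipliers}
    (hw : ∀ ω t, (P.sub ω t).DualFeasible (w ω t)) {X : Fin n → ℝ} {Y : P.Second}
    (h : P.Feasible D X Y) : P.cutVal w X ≤ P.secondCost Y :=
  Finset.sum_le_sum fun ω _ => Finset.sum_le_sum fun t _ =>
    (P.sub ω t).weak_duality (hw ω t) (h.2 ω t)

theorem continuous_cutVal (w : P.Multipliers) : Continuous (P.cutVal w) :=
  continuous_finsetSum _ fun ω _ => continuous_finsetSum _ fun t _ =>
    (P.sub ω t).continuous_dualObj (w ω t)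

namespace Regular

variable (hP : P.Regular)
include hP

theorem cutVal_le_recourse {w : P.Multipliers} (hw : ∀ ω t, (P.sub ω t).DualFeasible (w ω t))
    {X : Fin n → ℝ} (hX : X ∈ P.relaxedSet) : P.cutVal w X ≤ P.recourse X :=
  Finset.sum_le_sum fun ω _ => Finset.sum_le_sum fun t _ => (hP.sub X hX ω t).dualObj_le (hw ω t)

theorem cutVal_eq_recourse {X : Fin n → ℝ} (hX : X ∈ P.relaxedSet) {w : P.Multipliers}
    (hw : ∀ ω t, (P.sub ω t).DualOptimal X (w ω t)) : P.cutVal w X = P.recourse X :=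
  Finset.sum_congr rfl fun ω _ => Finset.sum_congr rfl fun t _ =>
    (hP.sub X hX ω t).dualObj_eq_value (hw ω t)

theorem exists_secondCost_le {X : Fin n → ℝ} (hX : X ∈ P.relaxedSet) {ε : ℝ} (hε : 0 < ε) :
    ∃ Y : P.Second, (∀ ω t, (P.sub ω t).Feasible X (Y ω t)) ∧
      P.secondCost Y ≤ P.recourse X + ε := by
  -- Each block gets the error `ε / (N + 1)`; the added 1 covers the case of no blocks.
  set N : ℝ := Fintype.card Ω * Fintype.card T with hN
  have hN0 : 0 ≤ N := by positivity
  choose Y hY hlt using fun ω t => (hP.sub X hX ω t).exists_lt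
    (div_pos hε (by linarith : 0 < N + 1))
  refine ⟨Y, hY, ?_⟩
  calc P.secondCost Y ≤ ∑ ω, ∑ t, ((P.sub ω t).value X + ε / (N + 1)) :=
        Finset.sum_le_sum fun ω _ => Finset.sum_le_sum fun t _ => (hlt ω t).le
    _ = P.recourse X + N * (ε / (N + 1)) := by
        simp only [Finset.sum_add_distrib, recourse, Finset.sum_const, Finset.card_univ,
          nsmul_eq_mul, hN]
        ring
    _ ≤ P.recourse X + ε := by
        have : N * (ε / (N + 1)) ≤ ε := by
          rw [mul_div_assoc', div_le_iff₀ (by linarith)]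
          nlinarith
        linarith

/-- The primal second-stage infimum need not be attained, so the bound is reached through nearly
optimal `Y`. -/
theorem optVal_le_cost {D : Set (Fin n → ℝ)} (hD : D ⊆ P.relaxedSet) {X : Fin n → ℝ}
    (hX : X ∈ D) : P.optVal D ≤ P.cost X := by
  refine EReal.le_of_forall_lt_iff_le.1 fun z hz => ?_
  rw [EReal.coe_lt_coe_iff] at hz
  obtain ⟨Y, hY, hle⟩ := hP.exists_secondCost_le (hD hX) (sub_pos.2 hz)
  refine (optVal_le_of_feasible (Y := Y) ⟨hX, hY⟩).trans (EReal.coe_le_coe_iff.2 ?_)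
  rw [cost] at hle
  linarith

theorem le_optVal {D : Set (Fin n → ℝ)} (hD : D ⊆ P.relaxedSet) {b : EReal}
    (hb : ∀ X ∈ D, b ≤ P.cost X) : b ≤ P.optVal D := by
  refine le_iInf fun X => le_iInf fun Y => le_iInf fun h => (hb X h.1).trans ?_
  refine EReal.coe_le_coe_iff.2 (add_le_add_right ?_ _)
  exact Finset.sum_le_sum fun ω _ => Finset.sum_le_sum fun t _ =>
    (hP.sub X (hD h.1) ω t).value_le (h.2 ω t)

theorem planCost_eq_cost {X : Fin n → ℝ} (hX : X ∈ P.relaxedSet) : P.planCost X = P.cost X :=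
  (hP.optVal_le_cost (Set.singleton_subset_iff.2 hX) rfl).antisymm
    (hP.le_optVal (Set.singleton_subset_iff.2 hX) (by rintro _ rfl; exact le_rfl))

theorem exists_modulus : ∃ ρ : (Fin n → ℝ) → ℝ, Continuous ρ ∧ ρ 0 = 0 ∧
    ∀ X ∈ P.relaxedSet, ∀ w : P.Multipliers, (∀ ω t, (P.sub ω t).DualOptimal X (w ω t)) →
      ∀ X₁ X₂, P.cutVal w X₁ - P.cutVal w X₂ ≤ ρ (X₁ - X₂) := by
  choose ρ hρ hρ0 h using fun ω t =>
    (P.sub ω t).exists_modulus hP.compact fun X hX => hP.sub X hX ω t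
  refine ⟨fun x => ∑ ω, ∑ t, ρ ω t x,
    continuous_finsetSum _ fun ω _ => continuous_finsetSum _ fun t _ => hρ ω t,
    by simp [hρ0], fun X hX w hw X₁ X₂ => ?_⟩
  simp only [cutVal, ← Finset.sum_sub_distrib]
  exact Finset.sum_le_sum fun ω _ => Finset.sum_le_sum fun t _ => h ω t X hX _ (hw ω t) X₁ X₂

/-- A cut generated at `X₁` is tight there and lies below the recourse at `X₂`, so the recourse
inherits the modulus of the cuts. -/
theorem recourse_sub_le {ρ : (Fin n → ℝ) → ℝ}
    (hρ : ∀ X ∈ P.relaxedSet, ∀ w : P.Multipliers, (∀ ω t, (P.sub ω t).DualOptimal X (w ω t)) →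
      ∀ X₁ X₂, P.cutVal w X₁ - P.cutVal w X₂ ≤ ρ (X₁ - X₂))
    {X₁ X₂ : Fin n → ℝ} (h₁ : X₁ ∈ P.relaxedSet) (h₂ : X₂ ∈ P.relaxedSet) :
    P.recourse X₁ - P.recourse X₂ ≤ ρ (X₁ - X₂) := by
  obtain ⟨w, hw⟩ := hP.exists_dualOptimal h₁
  have h3 := hρ X₁ h₁ w hw X₁ X₂
  have h4 := hP.cutVal_le_recourse (fun ω t => (hw ω t).1) h₂
  rw [hP.cutVal_eq_recourse h₁ hw] at h3
  linarith

theorem continuousOn_cost : ContinuousOn P.cost P.relaxedSet := by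
  obtain ⟨ρ, hρ, hρ0, h⟩ := hP.exists_modulus
  refine ContinuousOn.add (by fun_prop) fun X hX => ?_
  have h1 : Tendsto (fun X' => P.recourse X - ρ (X - X')) (𝓝[P.relaxedSet] X)
      (𝓝 (P.recourse X)) := by
    have : Continuous fun X' => P.recourse X - ρ (X - X') := by fun_prop
    simpa [hρ0] using this.continuousWithinAt (s := P.relaxedSet) (x := X) |>.tendsto
  have h2 : Tendsto (fun X' => P.recourse X + ρ (X' - X)) (𝓝[P.relaxedSet] X)
      (𝓝 (P.recourse X)) := by
    have : Continuous fun X' => P.recourse X + ρ (X' - X) := by fun_prop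
    simpa [hρ0] using this.continuousWithinAt (s := P.relaxedSet) (x := X) |>.tendsto
  refine tendsto_of_tendsto_of_tendsto_of_le_of_le' h1 h2 ?_ ?_
  · filter_upwards [self_mem_nhdsWithin] with X' hX'
    linarith [hP.recourse_sub_le h hX hX']
  · filter_upwards [self_mem_nhdsWithin] with X' hX'
    linarith [hP.recourse_sub_le h hX' hX]

theorem exists_optVal_eq (b : Bool) : ∃ X ∈ P.masterSet b,
    P.optVal (P.masterSet b) = P.cost X ∧ ∀ X' ∈ P.masterSet b, P.cost X ≤ P.cost X' := by
  obtain ⟨X, hX, hmin⟩ := (isCompact_masterSet hP.compact b).exists_isMinOn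
    (masterSet_nonempty hP.nonempty b) (hP.continuousOn_cost.mono (P.masterSet_subset b))
  refine ⟨X, hX, ?_, hmin⟩
  exact (hP.optVal_le_cost (P.masterSet_subset b) hX).antisymm
    (hP.le_optVal (P.masterSet_subset b) fun X' hX' => EReal.coe_le_coe_iff.2 (hmin hX'))

end Regular

/-- A nonempty finite list of cuts amounts to a single continuous lower bound for `z`. -/
theorem exists_continuous_cuts (cuts : List P.Multipliers) (hcuts : cuts ≠ []) :
    ∃ g : (Fin n → ℝ) → ℝ, Continuous g ∧ ∀ X (z : EReal),
      (∀ w ∈ cuts, ((P.cutVal w X : ℝ) : EReal) ≤ z) ↔ ((g X : ℝ) : EReal) ≤ z := by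
  induction cuts with
  | nil => exact absurd rfl hcuts
  | cons w l ih =>
    rcases eq_or_ne l [] with rfl | hl
    · exact ⟨P.cutVal w, continuous_cutVal w, by simp⟩
    · obtain ⟨g, hg, h⟩ := ih hl
      refine ⟨fun X => max (P.cutVal w X) (g X), (continuous_cutVal w).max hg, fun X z => ?_⟩
      rw [List.forall_mem_cons, h, EReal.coe_strictMono.monotone.map_max, max_le_iff]

theorem exists_masterOptimal {D : Set (Fin n → ℝ)} (hD : IsCompact D) (hne : D.Nonempty)
    (cuts : List P.Multipliers) : ∃ X z, P.MasterOptimal D cuts X z := by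
  rcases eq_or_ne cuts [] with rfl | hcuts
  · obtain ⟨X, hX⟩ := hne
    -- Without cuts `z = ⊥` is allowed, and a real number plus `⊥` is `⊥`, the least value.
    exact ⟨X, ⊥, ⟨hX, by simp⟩, fun X' z' _ => by simp⟩
  · obtain ⟨g, hg, h⟩ := exists_continuous_cuts cuts hcuts
    obtain ⟨X, hX, hmin⟩ := hD.exists_isMinOn hne
      (f := fun X => P.c ⬝ᵥ X + g X) (by fun_prop)
    refine ⟨X, g X, ⟨hX, (h X _).2 le_rfl⟩, fun X' z' h' => ?_⟩
    calc ((P.c ⬝ᵥ X : ℝ) : EReal) + g X ≤ ((P.c ⬝ᵥ X' : ℝ) : EReal) + g X' := by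
          exact_mod_cast hmin h'.1
      _ ≤ _ := add_le_add_right ((h X' z').1 h'.2) _

end Problem
end GBD

/-! ### The relative gap, single iterations and their invariant -/

namespace GBD

/-- The relative gap in terms of real inequalities. -/
theorem gap_le_iff {u : ℝ} (hu : 0 < u) (l : EReal) (ε : ℝ) :
    ((u : EReal) - l) / u ≤ ε ↔ ((u - ε * u : ℝ) : EReal) ≤ l := by
  induction l with
  | bot =>
    rw [EReal.coe_sub_bot, EReal.top_div_of_pos_ne_top (by exact_mod_cast hu) (EReal.coe_ne_top u)]
    simp only [top_le_iff, le_bot_iff, EReal.coe_ne_top, EReal.coe_ne_bot]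
  | coe l =>
    rw [← EReal.coe_sub, ← EReal.coe_div, EReal.coe_le_coe_iff, EReal.coe_le_coe_iff,
      div_le_iff₀ hu]
    constructor <;> intro h <;> linarith
  | top =>
    rw [EReal.sub_top, EReal.bot_div_of_pos_ne_top (by exact_mod_cast hu) (EReal.coe_ne_top u)]
    simp

namespace Problem

variable {n : ℕ} {Ω T : Type*} {P : Problem n Ω T} [Fintype Ω] [Fintype T]

namespace Regular

theorem optVal_masterSet_pos (hP : P.Regular) (hpos : 0 < P.optVal P.relaxedSet) (b : Bool) :
    0 < P.optVal (P.masterSet b) :=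
  hpos.trans_le <| hP.le_optVal (P.masterSet_subset b) fun _ hX =>
    hP.optVal_le_cost subset_rfl (P.masterSet_subset b hX)

end Regular

namespace StepWith

variable {ε₁ : ℝ} {s s' : P.State} {w : P.Multipliers} (h : P.StepWith ε₁ s s' w)
include h

theorem xhat_mem : s'.xhat ∈ P.masterSet s'.flag := h.master.1.1

theorem xhat_mem_relaxedSet : s'.xhat ∈ P.relaxedSet := P.masterSet_subset _ h.xhat_mem

theorem cost_eq (hP : P.Regular) : P.c ⬝ᵥ s'.xhat + P.cutVal w s'.xhat = P.cost s'.xhat := by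
  rw [hP.cutVal_eq_recourse h.xhat_mem_relaxedSet h.dual, cost]

theorem ub_eq_min_cost (hP : P.Regular) :
    s'.ub = min (P.resetUB ε₁ s) ((P.cost s'.xhat : ℝ) : EReal) := by
  rw [h.ub_eq, h.cost_eq hP]

theorem ub_le_cost (hP : P.Regular) : s'.ub ≤ P.cost s'.xhat := by
  rw [h.ub_eq_min_cost hP]; exact min_le_right _ _

theorem add_cutVal_le_lb {v : P.Multipliers} (hv : v ∈ s.cuts) :
    ((P.c ⬝ᵥ s'.xhat + P.cutVal v s'.xhat : ℝ) : EReal) ≤ s'.lb := by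
  rw [h.lb_eq, EReal.coe_add]
  exact add_le_add_right (h.master.1.2 v hv) _

/-- For every admissible `X`, the pair of `X` and its recourse satisfies all cuts, so the master
problem relaxes the problem with the same first-stage set. -/
theorem lb_le_optVal (hP : P.Regular)
    (hcuts : ∀ v ∈ s.cuts, ∀ ω t, (P.sub ω t).DualFeasible (v ω t)) :
    s'.lb ≤ P.optVal (P.masterSet s'.flag) := by
  refine hP.le_optVal (P.masterSet_subset _) fun X hX => ?_
  rw [h.lb_eq, cost, EReal.coe_add]
  exact h.master.2 X (P.recourse X) ⟨hX, fun v hv => EReal.coe_le_coe_iff.2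
    (hP.cutVal_le_recourse (hcuts v hv) (P.masterSet_subset _ hX))⟩

theorem flag_eq_of_not_switch (hsw : ¬ P.Switch ε₁ s) : s'.flag = s.flag := by
  have := h.flag_iff
  simp only [hsw, or_false] at this
  exact Bool.eq_iff_iff.2 this

end StepWith

/-- What holds in every state that occurs. -/
structure Invariant (s : P.State) : Prop where
  cuts : ∀ w ∈ s.cuts, ∀ ω t, (P.sub ω t).DualFeasible (w ω t)
  lb_le : s.lb ≤ P.optVal (P.masterSet s.flag)
  le_ub : P.optVal (P.masterSet s.flag) ≤ s.ub
  -- Iterates of the relaxed phase need not be integral; resetting UB to `⊤` discards them.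
  best : s.flag = true → s.ub ≠ ⊤ → s.best ∈ P.integerSet ∧ s.ub = P.cost s.best
  gap : s.gap = ⊤ ∨ (s.gap = (s.ub - s.lb) / s.ub ∧ s.ub ≠ ⊤)

theorem invariant_start (flag₀ : Bool) : Invariant (P.start flag₀) :=
  ⟨by simp [start], bot_le, le_top, fun _ h => absurd rfl h, Or.inl rfl⟩

theorem StepWith.invariant {ε₁ : ℝ} {s s' : P.State} {w : P.Multipliers}
    (h : P.StepWith ε₁ s s' w) (hP : P.Regular) (hs : Invariant s) : Invariant s' := by
  refine ⟨?_, h.lb_le_optVal hP hs.cuts, ?_, fun hf _ => ?_, Or.inr ⟨h.gap_eq, ?_⟩⟩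
  · rw [h.cuts_eq]
    intro v hv
    rcases List.mem_append.1 hv with hv | hv
    · exact hs.cuts v hv
    · obtain rfl := List.mem_singleton.1 hv
      exact fun ω t => (h.dual ω t).1
  · rw [h.ub_eq_min_cost hP]
    refine le_min ?_ (hP.optVal_le_cost (P.masterSet_subset _) h.xhat_mem)
    -- At the switch the optimal value may rise above the old UB; the reset to `⊤` saves the
    -- inequality. Otherwise the first-stage set is unchanged.
    by_cases hsw : P.Switch ε₁ s
    · simp [resetUB, hsw]
    · rw [h.flag_eq_of_not_switch hsw]
      simpa [resetUB, hsw] using hs.le_ub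
  · have hx := h.xhat_mem
    rw [hf] at hx
    rw [h.ub_eq_min_cost hP]
    rcases lt_or_ge ((P.cost s'.xhat : ℝ) : EReal) (P.resetUB ε₁ s) with hlt | hge
    · rw [h.best_new (by rwa [h.cost_eq hP]), min_eq_right hlt.le]
      exact ⟨hx, rfl⟩
    · rw [h.best_old (by rwa [h.cost_eq hP]), min_eq_left hge]
      have hne : P.resetUB ε₁ s ≠ ⊤ := (hge.trans_lt (EReal.coe_lt_top _)).ne
      by_cases hsw : P.Switch ε₁ s
      · simp [resetUB, hsw] at hne
      · simp only [resetUB, hsw, if_false] at hne ⊢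
        exact hs.best (by rw [← h.flag_eq_of_not_switch hsw, hf]) hne
  · exact ((h.ub_le_cost hP).trans_lt (EReal.coe_lt_top _)).ne

theorem Regular.invariant_of_reachable (hP : P.Regular) {ε₁ : ℝ} {flag₀ : Bool} {s : P.State}
    (h : P.Reachable ε₁ flag₀ s) : Invariant s := by
  induction h with
  | refl => exact invariant_start flag₀
  | tail _ hstep ih => obtain ⟨w, hw⟩ := hstep; exact hw.invariant hP ih

theorem Invariant.exists_ub_eq {s : P.State} (hs : Invariant s)
    (hpos : ∀ b, 0 < P.optVal (P.masterSet b)) (hub : s.ub ≠ ⊤) :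
    ∃ u : ℝ, s.ub = u ∧ 0 < u := by
  have h0 : 0 < s.ub := (hpos _).trans_le hs.le_ub
  lift s.ub to ℝ using ⟨hub, h0.ne_bot⟩ with u hu
  exact ⟨u, rfl, by exact_mod_cast h0⟩

theorem Regular.exists_step (hP : P.Regular) (ε₁ : ℝ) (s : P.State) : ∃ s', P.Step ε₁ s s' := by
  classical
  let flag : Bool := decide (s.flag = true ∨ P.Switch ε₁ s)
  obtain ⟨X, z, hXz⟩ := exists_masterOptimal (isCompact_masterSet hP.compact flag)
    (masterSet_nonempty hP.nonempty flag) s.cuts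
  obtain ⟨w, hw⟩ := hP.exists_dualOptimal (P.masterSet_subset _ hXz.1.1)
  let c : EReal := ((P.c ⬝ᵥ X + P.cutVal w X : ℝ) : EReal)
  let ub : EReal := min (P.resetUB ε₁ s) c
  let lb : EReal := ((P.c ⬝ᵥ X : ℝ) : EReal) + z
  exact ⟨⟨s.iter + 1, flag, lb, ub, (ub - lb) / ub, X, z,
    if c < P.resetUB ε₁ s then X else s.best, s.cuts ++ [w]⟩, w,
    { iter_eq := rfl
      flag_iff := decide_eq_true_iff
      master := hXz
      lb_eq := rfl
      dual := hw
      ub_eq := rfl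
      best_new := fun h => if_pos h
      best_old := fun h => if_neg h.not_gt
      cuts_eq := rfl
      gap_eq := rfl }⟩

theorem mem_cuts_of_lt {ε₁ : ℝ} {s : ℕ → P.State} {w : ℕ → P.Multipliers}
    (hs : ∀ k, P.StepWith ε₁ (s k) (s (k + 1)) (w k)) {i k : ℕ} (hik : i < k) :
    w i ∈ (s k).cuts := by
  induction k, hik using Nat.le_induction with
  | base => simp [(hs i).cuts_eq]
  | succ k _ ih => simp [(hs k).cuts_eq, ih]

/-! ### Convergence and termination of runs -/

namespace Regular

variable (hP : P.Regular) {ε₁ : ℝ} {s : ℕ → P.State}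
include hP

theorem invariant_of_run {flag₀ : Bool} (h0 : s 0 = P.start flag₀)
    (hs : ∀ k, P.Step ε₁ (s k) (s (k + 1))) (k : ℕ) : Invariant (s k) := by
  induction k with
  | zero => rw [h0]; exact invariant_start flag₀
  | succ k ih => obtain ⟨w, hw⟩ := hs k; exact hw.invariant hP ih

/-- The cut of an earlier iterate makes the lower bound nearly tight at a nearby later iterate. -/
theorem exists_lb_modulus (hs : ∀ k, P.Step ε₁ (s k) (s (k + 1))) :
    ∃ ρ : (Fin n → ℝ) → ℝ, Continuous ρ ∧ ρ 0 = 0 ∧ ∀ i k, i < k →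
      ((P.cost (s (k + 1)).xhat - ρ ((s (k + 1)).xhat - (s (i + 1)).xhat) : ℝ) : EReal) ≤
        (s (k + 1)).lb := by
  choose w hw using hs
  obtain ⟨ρ, hρ, hρ0, h⟩ := hP.exists_modulus
  -- One term pays for the change of the cut `w i`, which is tight at iterate `i + 1`, the other for
  -- the change of the recourse between the two iterates.
  refine ⟨fun x => ρ x + ρ (-x), by fun_prop, by simp [hρ0], fun i k hik => ?_⟩
  refine le_trans (EReal.coe_le_coe_iff.2 ?_)
    ((hw k).add_cutVal_le_lb (mem_cuts_of_lt hw hik))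
  have h1 := h _ (hw i).xhat_mem_relaxedSet (w i) (hw i).dual (s (i + 1)).xhat (s (k + 1)).xhat
  have h2 := hP.recourse_sub_le h (hw k).xhat_mem_relaxedSet (hw i).xhat_mem_relaxedSet
  rw [hP.cutVal_eq_recourse (hw i).xhat_mem_relaxedSet (hw i).dual] at h1
  simp only [cost, neg_sub]
  linarith

/-- Infinitely many violations would have a convergent subsequence of iterates in the compact set.
Two consecutive members get arbitrarily close, and the cut of the earlier one refutes the violation
at the later one. -/
theorem eventually_cost_sub_le_lb (hs : ∀ k, P.Step ε₁ (s k) (s (k + 1))) {ε : ℝ} (hε : 0 < ε) :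
    ∀ᶠ k in atTop, ((P.cost (s k).xhat - ε : ℝ) : EReal) ≤ (s k).lb := by
  suffices h : ∀ᶠ k in atTop, ((P.cost (s (k + 1)).xhat - ε : ℝ) : EReal) ≤ (s (k + 1)).lb by
    obtain ⟨N, hN⟩ := eventually_atTop.1 h
    refine eventually_atTop.2 ⟨N + 1, fun k hk => ?_⟩
    obtain ⟨k, rfl⟩ := Nat.exists_eq_add_of_le' (le_of_add_le_right hk)
    exact hN k (by omega)
  obtain ⟨ρ, hρ, hρ0, h⟩ := hP.exists_lb_modulus hs
  by_contra hbad
  obtain ⟨φ, hφ, hφbad⟩ := extraction_of_frequently_atTop (not_eventually.1 hbad)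
  obtain ⟨a, -, ψ, hψ, ha⟩ := hP.compact.tendsto_subseq (x := fun k => (s (φ k + 1)).xhat)
    fun k => (hs (φ k)).choose_spec.xhat_mem_relaxedSet
  have h1 := (hρ.tendsto _).comp ((ha.comp (tendsto_add_atTop_nat 1)).sub ha)
  rw [sub_self, hρ0] at h1
  obtain ⟨k, hk⟩ := (h1.eventually_lt_const hε).exists
  refine hφbad (ψ (k + 1)) (le_trans (EReal.coe_le_coe_iff.2 ?_)
    (h (φ (ψ k)) (φ (ψ (k + 1))) (hφ (hψ k.lt_succ_self))))
  simp only [Function.comp_apply] at hk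
  linarith

/-- UB may come from an older iterate; it is only known to lie between the optimal value and the
current cost, so the estimate is required for every such `u`. -/
theorem gap_le_of_step {t t' : P.State} {w : P.Multipliers} (h : P.StepWith ε₁ t t' w)
    (hpos : ∀ b, 0 < P.optVal (P.masterSet b)) (ht : Invariant t) {ε : ℝ}
    (hle : ∀ u : ℝ, 0 < u → P.optVal (P.masterSet t'.flag) ≤ u → u ≤ P.cost t'.xhat →
      ((u - ε * u : ℝ) : EReal) ≤ t'.lb) : t'.gap ≤ ε := by
  have hI := h.invariant hP ht
  have hub := h.ub_le_cost hP
  have hu2 := hI.le_ub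
  obtain ⟨u, hu, hu0⟩ := hI.exists_ub_eq hpos (hub.trans_lt (EReal.coe_lt_top _)).ne
  rw [hu] at hub hu2
  rw [h.gap_eq, hu, gap_le_iff hu0]
  exact hle u hu0 hu2 (EReal.coe_le_coe_iff.1 hub)

theorem eventually_gap_le {flag₀ : Bool} (hpos : 0 < P.optVal P.relaxedSet)
    (h0 : s 0 = P.start flag₀) (hs : ∀ k, P.Step ε₁ (s k) (s (k + 1))) {ε : ℝ} (hε : 0 < ε) :
    ∀ᶠ k in atTop, (s k).gap ≤ ε := by
  obtain ⟨X, hX, hv, hmin⟩ := hP.exists_optVal_eq false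
  have hv0 := hP.optVal_masterSet_pos hpos false
  rw [hv, EReal.coe_pos] at hv0
  -- The tolerance is `ε` times the relaxed optimum, which bounds UB from below in both phases.
  -- Index 0 is excluded because its gap is `⊤`.
  filter_upwards [hP.eventually_cost_sub_le_lb hs (mul_pos hε hv0), eventually_ge_atTop 1]
    with k hk hk1
  obtain ⟨k, rfl⟩ := Nat.exists_eq_add_of_le' hk1
  obtain ⟨w, hw⟩ := hs k
  refine hP.gap_le_of_step hw (hP.optVal_masterSet_pos hpos) (hP.invariant_of_run h0 hs k)
    fun u _ hu2 hu => le_trans (EReal.coe_le_coe_iff.2 ?_) hk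
  have h3 : ((P.cost X : ℝ) : EReal) ≤ u := by
    refine le_trans ?_ hu2
    exact hP.le_optVal (P.masterSet_subset _) fun X' hX' =>
      EReal.coe_le_coe_iff.2 (hmin X' (P.masterSet_subset _ hX'))
  have h4 := mul_le_mul_of_nonneg_left (EReal.coe_le_coe_iff.1 h3) hε.le
  linarith

theorem exists_forall_flag {flag₀ : Bool} (hpos : 0 < P.optVal P.relaxedSet) (hε₁ : 0 < ε₁)
    (h0 : s 0 = P.start flag₀) (hs : ∀ k, P.Step ε₁ (s k) (s (k + 1))) :
    ∃ K, ∀ k, K ≤ k → (s k).flag = true := by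
  obtain ⟨N, hN⟩ := (hP.eventually_gap_le hpos h0 hs hε₁).exists
  refine ⟨N + 1, fun k hk => ?_⟩
  induction k, hk using Nat.le_induction with
  | base =>
    obtain ⟨w, hw⟩ := hs N
    refine hw.flag_iff.2 ?_
    by_cases hf : (s N).flag = true
    · exact Or.inl hf
    · exact Or.inr ⟨hN, by simpa using hf⟩
  | succ k _ ih =>
    obtain ⟨w, hw⟩ := hs k
    exact hw.flag_iff.2 (Or.inl ih)

theorem exists_terminated_of_run {flag₀ : Bool} {ε₂ : ℝ} (hpos : 0 < P.optVal P.relaxedSet)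
    (hε₁ : 0 < ε₁) (hε₂ : 0 < ε₂ ∨ (ε₂ = 0 ∧ P.integerSet.Finite)) (h0 : s 0 = P.start flag₀)
    (hs : ∀ k, P.Step ε₁ (s k) (s (k + 1))) : ∃ N, P.Terminated ε₂ (s N) := by
  obtain ⟨K, hK⟩ := hP.exists_forall_flag hpos hε₁ h0 hs
  rcases hε₂ with hε₂ | ⟨rfl, hfin⟩
  · obtain ⟨N, hN, hN'⟩ :=
      ((hP.eventually_gap_le hpos h0 hs hε₂).and (eventually_ge_atTop K)).exists
    exact ⟨N, hK N hN', hN⟩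
  · have hmaps : Set.MapsTo (fun k => (s (k + 1)).xhat) (Set.Ici K) P.integerSet := by
      intro k hk
      have := (hs k).choose_spec.xhat_mem
      rwa [hK (k + 1) (Nat.le_succ_of_le hk)] at this
    -- By pigeonhole an integer iterate recurs. Its earlier cut is exact there, so LB is at least
    -- its cost, hence at least UB.
    obtain ⟨i, hi, k, -, hik, heq⟩ := (Set.Ici_infinite K).exists_lt_map_eq_of_mapsTo hmaps hfin
    obtain ⟨ρ, -, hρ0, h⟩ := hP.exists_lb_modulus hs
    have h1 := h i k hik
    rw [show (s (i + 1)).xhat = (s (k + 1)).xhat from heq, sub_self, hρ0, sub_zero] at h1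
    obtain ⟨w, hw⟩ := hs k
    refine ⟨k + 1, hK _ (Nat.le_succ_of_le ((Set.mem_Ici.1 hi).trans hik.le)), ?_⟩
    refine hP.gap_le_of_step hw (hP.optVal_masterSet_pos hpos) (hP.invariant_of_run h0 hs k)
      fun u _ _ hu => le_trans (EReal.coe_le_coe_iff.2 ?_) h1
    linarith

/-- Once the flag is set, F(x) - ε ≤ LB ≤ v* ≤ UB ≤ F(x) eventually holds at the current iterate x,
for every ε > 0. Cluster points follow from closedness of 𝕏 and continuity of the cost. -/
theorem tendsto_of_run {flag₀ : Bool} (hpos : 0 < P.optVal P.relaxedSet)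
    (hε₁ : 0 < ε₁) (h0 : s 0 = P.start flag₀) (hs : ∀ k, P.Step ε₁ (s k) (s (k + 1))) :
    Tendsto (fun k => (s k).lb) atTop (𝓝 (P.optVal P.integerSet)) ∧
      Tendsto (fun k => (s k).ub) atTop (𝓝 (P.optVal P.integerSet)) ∧
      ∀ X, MapClusterPt X atTop (fun k => (s k).xhat) →
        X ∈ P.integerSet ∧ P.planCost X = P.optVal P.integerSet := by
  obtain ⟨K, hK⟩ := hP.exists_forall_flag hpos hε₁ h0 hs
  obtain ⟨X₀, hX₀, hv, hmin⟩ := hP.exists_optVal_eq true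
  change P.optVal P.integerSet = P.cost X₀ at hv
  have hlate : ∀ᶠ k in atTop, (s k).lb ≤ P.cost X₀ ∧ ((P.cost X₀ : ℝ) : EReal) ≤ (s k).ub ∧
      (s k).xhat ∈ P.integerSet ∧ (s k).ub ≤ P.cost (s k).xhat := by
    filter_upwards [eventually_ge_atTop (K + 1)] with k hk
    obtain ⟨k, rfl⟩ := Nat.exists_eq_add_of_le' (le_of_add_le_right hk)
    obtain ⟨w, hw⟩ := hs k
    have hI := hP.invariant_of_run h0 hs (k + 1)
    have hf := hK (k + 1) (by omega)
    have h1 := hI.lb_le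
    have h2 := hI.le_ub
    have h3 := hw.xhat_mem
    rw [hf] at h1 h2 h3
    change _ ≤ P.optVal P.integerSet at h1
    change P.optVal P.integerSet ≤ _ at h2
    rw [hv] at h1 h2
    exact ⟨h1, h2, h3, hw.ub_le_cost hP⟩
  have hcost : ∀ ε > 0, ∀ᶠ k in atTop, P.cost (s k).xhat ≤ P.cost X₀ + ε := by
    intro ε hε
    filter_upwards [hlate, hP.eventually_cost_sub_le_lb hs hε] with k h1 h2
    have := EReal.coe_le_coe_iff.1 (h2.trans h1.1)
    linarith
  refine ⟨?_, ?_, fun X hX => ?_⟩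
  · rw [hv]
    refine tendsto_order.2 ⟨fun a ha => ?_, fun b hb => ?_⟩
    · obtain ⟨z, haz, hz⟩ := EReal.lt_iff_exists_real_btwn.1 ha
      rw [EReal.coe_lt_coe_iff] at hz
      filter_upwards [hlate, hP.eventually_cost_sub_le_lb hs (sub_pos.2 hz)] with k h1 h2
      refine haz.trans_le (le_trans (EReal.coe_le_coe_iff.2 ?_) h2)
      linarith [hmin _ h1.2.2.1]
    · filter_upwards [hlate] with k h1
      exact h1.1.trans_lt hb
  · rw [hv]
    refine tendsto_order.2 ⟨fun a ha => ?_, fun b hb => ?_⟩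
    · filter_upwards [hlate] with k h1
      exact ha.trans_le h1.2.1
    · obtain ⟨z, hz, hzb⟩ := EReal.lt_iff_exists_real_btwn.1 hb
      rw [EReal.coe_lt_coe_iff] at hz
      filter_upwards [hlate, hcost _ (sub_pos.2 hz)] with k h1 h2
      refine lt_of_le_of_lt (h1.2.2.2.trans (EReal.coe_le_coe_iff.2 ?_)) hzb
      linarith
  · obtain ⟨ψ, hψ, hlim⟩ := hX.tendsto_subseq
    have hψt := hψ.tendsto_atTop
    have hmem : ∀ᶠ k in atTop, (s (ψ k)).xhat ∈ P.integerSet :=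
      (hψt.eventually hlate).mono fun k h => h.2.2.1
    have hXmem : X ∈ P.integerSet :=
      (isCompact_integerSet hP.compact).isClosed.mem_of_tendsto hlim hmem
    have hXC := P.integerSet_subset hXmem
    refine ⟨hXmem, ?_⟩
    have hlim' : Tendsto (fun k => P.cost (s (ψ k)).xhat) atTop (𝓝 (P.cost X)) :=
      (hP.continuousOn_cost X hXC).tendsto.comp (tendsto_nhdsWithin_iff.2
        ⟨hlim, hmem.mono fun k h => P.integerSet_subset h⟩)
    rw [hP.planCost_eq_cost hXC, hv, EReal.coe_eq_coe_iff]
    refine le_antisymm (le_of_forall_pos_le_add fun ε hε => ?_) (hmin X hXmem)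
    exact le_of_tendsto hlim' (hψt.eventually (hcost ε hε))

theorem optimal_of_terminated {flag₀ : Bool} {ε₂ : ℝ} (hpos : 0 < P.optVal P.relaxedSet)
    {t : P.State} (ht : P.Reachable ε₁ flag₀ t) (hT : P.Terminated ε₂ t) :
    t.best ∈ P.integerSet ∧ t.ub = P.planCost t.best ∧
      ∃ v w : ℝ, P.optVal P.integerSet = v ∧ P.planCost t.best = w ∧
        v ≤ w ∧ w - v ≤ ε₂ * w := by
  obtain ⟨hf, hgap⟩ := hT
  have hI := hP.invariant_of_reachable ht
  -- A gap of `⊤`, as in the initial state, never passes the stopping test. Otherwise UB - ε₂ UB ≤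
  -- LB ≤ v*.
  rcases hI.gap with hg | ⟨hg, hub⟩
  · rw [hg, top_le_iff] at hgap
    exact absurd hgap (EReal.coe_ne_top _)
  obtain ⟨hbest, hcost⟩ := hI.best hf hub
  have hplan := hP.planCost_eq_cost (P.integerSet_subset hbest)
  obtain ⟨u, hu, hu0⟩ := hI.exists_ub_eq (hP.optVal_masterSet_pos hpos) hub
  obtain ⟨X, hX, hv, hmin⟩ := hP.exists_optVal_eq true
  obtain rfl : u = P.cost t.best := EReal.coe_eq_coe_iff.1 (hu.symm.trans hcost)
  refine ⟨hbest, hcost.trans hplan.symm, P.cost X, P.cost t.best, hv, hplan, hmin _ hbest, ?_⟩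
  rw [hg, hu, gap_le_iff hu0] at hgap
  have hlb := hI.lb_le
  rw [hf, hv] at hlb
  linarith [EReal.coe_le_coe_iff.1 (hgap.trans hlb)]

end Regular

end Problem
end GBD

theorem mainTheorem2 {n : ℕ} {Ω T : Type*} [Fintype Ω] [Fintype T] (P : GBD.Problem n Ω T)
    (hcompact : IsCompact P.relaxedSet) (hne : P.integerSet.Nonempty)
    (hstrict : ∀ X ∈ P.relaxedSet, ∀ ω t, (P.sub ω t).StrictlyFeasible X)
    (hpos : 0 < P.optVal P.relaxedSet)
    (ε₁ ε₂ : ℝ) (hε₁ : 0 < ε₁) (hε₂ : 0 < ε₂ ∨ (ε₂ = 0 ∧ P.integerSet.Finite))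
    (flag₀ : Bool) :
    -- the optimal value is finite and attained by a first-stage decision
    (∃ v : ℝ, P.optVal P.integerSet = v) ∧
    (∃ X ∈ P.integerSet, P.planCost X = P.optVal P.integerSet) ∧
    -- every iteration can be carried out
    (∀ s, P.Reachable ε₁ flag₀ s → ∃ s', P.Step ε₁ s s') ∧
    -- every cut generated in either phase is valid for the relaxed and the integer problem
    (∀ s, P.Reachable ε₁ flag₀ s → ∀ w ∈ s.cuts, ∀ X Y, P.Feasible P.relaxedSet X Y →
      P.cutVal w X ≤ P.secondCost Y) ∧
    -- once the integer constraints are restored, the bounds enclose the optimal value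
    (∀ s, P.Reachable ε₁ flag₀ s → s.flag = true →
      s.lb ≤ P.optVal P.integerSet ∧ P.optVal P.integerSet ≤ s.ub) ∧
    -- every run stops after finitely many iterations
    (∀ s : ℕ → P.State, s 0 = P.start flag₀ →
      (∀ k, ¬ P.Terminated ε₂ (s k) → P.Step ε₁ (s k) (s (k + 1))) →
      ∃ N, P.Terminated ε₂ (s N)) ∧
    -- on stopping, the best integer iterate is a global optimum up to the relative gap `ε₂`
    (∀ s, P.Reachable ε₁ flag₀ s → P.Terminated ε₂ s →
      s.best ∈ P.integerSet ∧ s.ub = P.planCost s.best ∧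
      ∃ v w : ℝ, P.optVal P.integerSet = v ∧ P.planCost s.best = w ∧
        v ≤ w ∧ w - v ≤ ε₂ * w) ∧
    -- without the stopping test, the bounds and the iterates converge to the global optimum
    (∀ s : ℕ → P.State, s 0 = P.start flag₀ → (∀ k, P.Step ε₁ (s k) (s (k + 1))) →
      (∃ K, ∀ k, K ≤ k → (s k).flag = true) ∧
      Tendsto (fun k => (s k).lb) atTop (𝓝 (P.optVal P.integerSet)) ∧
      Tendsto (fun k => (s k).ub) atTop (𝓝 (P.optVal P.integerSet)) ∧
      ∀ X, MapClusterPt X atTop (fun k => (s k).xhat) →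
        X ∈ P.integerSet ∧ P.planCost X = P.optVal P.integerSet) := by
  have hP := GBD.Problem.regular_of_optVal_pos hcompact hne hstrict hpos
  obtain ⟨X, hX, hv, -⟩ := hP.exists_optVal_eq true
  refine ⟨⟨P.cost X, hv⟩, ⟨X, hX, (hP.planCost_eq_cost hX.1).trans hv.symm⟩,
    fun s _ => hP.exists_step ε₁ s,
    fun s hs w hw X Y hXY =>
      GBD.Problem.cutVal_le_secondCost ((hP.invariant_of_reachable hs).cuts w hw) hXY,
    fun s hs hf => ?_, fun s h0 hs => ?_,
    fun s hs hT => hP.optimal_of_terminated hpos hs hT,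
    fun s h0 hs => ⟨hP.exists_forall_flag hpos hε₁ h0 hs, hP.tendsto_of_run hpos hε₁ h0 hs⟩⟩
  · have hI := hP.invariant_of_reachable hs
    have h1 := hI.lb_le
    have h2 := hI.le_ub
    rw [hf] at h1 h2
    exact ⟨h1, h2⟩
  -- A run that never stops takes a genuine step at every index, so the result on infinite runs
  -- applies.
  · by_contra hT
    rw [not_exists] at hT
    obtain ⟨N, hN⟩ := hP.exists_terminated_of_run hpos hε₁ hε₂ h0 fun k => hs k (hT k)
    exact hT N hN
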